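/- Let $R$ be any associative ring with identity; "$R$-module" means left $R$-module and "$R^\circ$-module" means right $R$-module. Call a class of modules over a ring definable if it is closed under products, direct limits and pure submodules, and let $\langle Inj\rangle$ be the definable class generated by the injective $R^\circ$-modules, i.e. the smallest definable class containing them. ($\langle Inj\rangle$ is the injective class of the duality pair $(\langle Flat\rangle,\langle Inj\rangle)$, where $\langle Flat\rangle$ is the definable class generated by the flat $R$-modules.) A module $A$ is FP-injective (absolutely pure) if $\operatorname{Ext}^1(P,A)=0$ for all finitely presented $P$. Complexes are $\mathbb{Z}$-indexed chain complexes, and $Z_0$ denotes the kernel of the differential leaving degree $0$. Let $\mathcal{B}$ be a class of $R^\circ$-modules. An $R^\circ$-module $N$ is Gorenstein $\mathcal{B}$-injective if $N\cong Z_0E$ for an exact complex $E$ of injective $R^\circ$-modules such that $\operatorname{Hom}(B,E)$ is exact for all $B\in\mathcal{B}$; it is Ding injective if this holds with $\mathcal{B}$ the class of FP-injective $R^\circ$-modules. An $R$-module $N$ is Gorenstein $\mathcal{B}$-flat (resp. projectively coresolved Gorenstein $\mathcal{B}$-flat) if $N\cong Z_0F$ for an exact complex $F$ of flat (resp. projective)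 $R$-modules such that $B\otimes_R F$ is exact for all $B\in\mathcal{B}$; it is Gorenstein flat (resp. projectively coresolved Gorenstein flat) if this holds with $\mathcal{B}$ the class of injective $R^\circ$-modules. Then the following hold. 1. An $R^\circ$-module is Ding injective if and only if it is Gorenstein $\langle Inj\rangle$-injective. Moreover, for every exact complex $E$ of injective $R^\circ$-modules, $\operatorname{Hom}(A,E)$ is exact for all FP-injective $A$ if and only if $\operatorname{Hom}(M,E)$ is exact for all $M\in\langle Inj\rangle$. 2. An $R$-module is Gorenstein flat if and only if it is Gorenstein $\langle Inj\rangle$-flat. Moreover, for every exact complex $F$ of flat $R$-modules, $I\otimes_R F$ is exact for all injective $R^\circ$-modules $I$ if and only if $M\otimes_R F$ is exact for all $M\in\langle Inj\rangle$. 3. In particular, an $R$-module is projectively coresolved Gorenstein flat if and only if it is projectively coresolved Gorenstein $\langle Inj\rangle$-flat. Moreover, for every exact complex $P$ of projective $R$-modules, $I\otimes_R P$ is exact for all injective $R^\circ$-modules $I$ if and only if $M\otimes_R P$ is exact for all $M\in\langle Inj\rangle$. -/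

import Mathlib

universe u

open CategoryTheory TensorProduct

/-! Left `R`-modules are objects of `ModuleCat.{u} R`, and right `R`-modules are objects of
`ModuleCat.{u} Rᵐᵒᵖ` (so that `m r` is `MulOpposite.op r • m`).  A class of modules is an
`ObjectProperty`. -/

namespace DingModules

/-! ### Tensor products over a noncommutative ring -/

section Tensor

/-- The subgroup of `M ⊗_ℤ N` generated by all `(m r) ⊗ n - m ⊗ (r n)`. -/
def balancingSubgroup (R M N : Type u) [Ring R] [AddCommGroup M] [Module Rᵐᵒᵖ M]
    [AddCommGroup N] [Module R N] : AddSubgroup (M ⊗[ℤ] N) :=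
  AddSubgroup.closure
    {t | ∃ (m : M) (r : R) (n : N), t = (MulOpposite.op r • m) ⊗ₜ[ℤ] n - m ⊗ₜ[ℤ] (r • n)}

/-- The abelian group `M ⊗_R N`, for a right `R`-module `M` and a left `R`-module `N`. -/
abbrev BalancedTensor (R M N : Type u) [Ring R] [AddCommGroup M] [Module Rᵐᵒᵖ M]
    [AddCommGroup N] [Module R N] : Type u :=
  (M ⊗[ℤ] N) ⧸ balancingSubgroup R M N

/-- The map `f ⊗ g` on tensor products over `ℤ`. -/
def intTensorMap {R M M' N N' : Type u} [Ring R]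
    [AddCommGroup M] [Module Rᵐᵒᵖ M] [AddCommGroup M'] [Module Rᵐᵒᵖ M']
    [AddCommGroup N] [Module R N] [AddCommGroup N'] [Module R N']
    (f : M →ₗ[Rᵐᵒᵖ] M') (g : N →ₗ[R] N') : M ⊗[ℤ] N →+ M' ⊗[ℤ] N' :=
  (TensorProduct.map f.toAddMonoidHom.toIntLinearMap
    g.toAddMonoidHom.toIntLinearMap).toAddMonoidHom

@[simp]
theorem intTensorMap_tmul {R M M' N N' : Type u} [Ring R]
    [AddCommGroup M] [Module Rᵐᵒᵖ M] [AddCommGroup M'] [Module Rᵐᵒᵖ M']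
    [AddCommGroup N] [Module R N] [AddCommGroup N'] [Module R N']
    (f : M →ₗ[Rᵐᵒᵖ] M') (g : N →ₗ[R] N') (m : M) (n : N) :
    intTensorMap f g (m ⊗ₜ[ℤ] n) = f m ⊗ₜ[ℤ] g n := rfl

theorem balancingSubgroup_le_comap {R M M' N N' : Type u} [Ring R]
    [AddCommGroup M] [Module Rᵐᵒᵖ M] [AddCommGroup M'] [Module Rᵐᵒᵖ M']
    [AddCommGroup N] [Module R N] [AddCommGroup N'] [Module R N']
    (f : M →ₗ[Rᵐᵒᵖ] M') (g : N →ₗ[R] N') :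
    balancingSubgroup R M N ≤ (balancingSubgroup R M' N').comap (intTensorMap f g) := by
  refine (AddSubgroup.closure_le _).2 ?_
  rintro _ ⟨m, r, n, rfl⟩
  refine AddSubgroup.subset_closure ⟨f m, r, g n, ?_⟩
  simp [map_sub]

/-- The map `f ⊗_R g : M ⊗_R N → M' ⊗_R N'`. -/
def BalancedTensor.map {R M M' N N' : Type u} [Ring R]
    [AddCommGroup M] [Module Rᵐᵒᵖ M] [AddCommGroup M'] [Module Rᵐᵒᵖ M']
    [AddCommGroup N] [Module R N] [AddCommGroup N'] [Module R N']
    (f : M →ₗ[Rᵐᵒᵖ] M') (g : N →ₗ[R] N') : BalancedTensor R M N →+ BalancedTensor R M' N' :=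
  QuotientAddGroup.map _ _ (intTensorMap f g) (balancingSubgroup_le_comap f g)

theorem BalancedTensor.hom_ext {R M N : Type u} [Ring R] [AddCommGroup M] [Module Rᵐᵒᵖ M]
    [AddCommGroup N] [Module R N] {A : Type u} [AddCommGroup A]
    {φ ψ : BalancedTensor R M N →+ A}
    (h : ∀ (m : M) (n : N), φ (QuotientAddGroup.mk (m ⊗ₜ[ℤ] n)) =
      ψ (QuotientAddGroup.mk (m ⊗ₜ[ℤ] n))) : φ = ψ := by
  refine QuotientAddGroup.addMonoidHom_ext _ ?_
  ext t
  induction t with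
  | zero => simp
  | tmul m n => exact h m n
  | add x y hx hy => rw [map_add, map_add, hx, hy]

/-- The functor `M ⊗_R -` from left `R`-modules to abelian groups, for a right `R`-module `M`. -/
def tensorFunctor {R : Type u} [Ring R] (M : ModuleCat.{u} Rᵐᵒᵖ) :
    ModuleCat.{u} R ⥤ AddCommGrpCat.{u} where
  obj N := AddCommGrpCat.of (BalancedTensor R M N)
  map g := AddCommGrpCat.ofHom (BalancedTensor.map LinearMap.id g.hom)
  map_id N := by
    ext1
    exact BalancedTensor.hom_ext fun m n => rfl
  map_comp f g := by
    ext1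
    exact BalancedTensor.hom_ext fun m n => rfl

instance {R : Type u} [Ring R] (M : ModuleCat.{u} Rᵐᵒᵖ) : (tensorFunctor M).Additive where
  map_add {X Y f g} := by
    ext1
    refine BalancedTensor.hom_ext fun m n => ?_
    change (QuotientAddGroup.mk (m ⊗ₜ[ℤ] (f.hom n + g.hom n)) : BalancedTensor R M Y) =
      QuotientAddGroup.mk (m ⊗ₜ[ℤ] f.hom n) + QuotientAddGroup.mk (m ⊗ₜ[ℤ] g.hom n)
    rw [TensorProduct.tmul_add]
    rfl

end Tensor

/-! ### Classes of modules -/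

/-- A left `R`-module `F` is flat if `- ⊗_R F` preserves injections of right `R`-modules. -/
def IsFlat {R : Type u} [Ring R] (F : ModuleCat.{u} R) : Prop :=
  ∀ (M M' : ModuleCat.{u} Rᵐᵒᵖ) (f : M →ₗ[Rᵐᵒᵖ] M'), Function.Injective f →
    Function.Injective (BalancedTensor.map f (LinearMap.id : F →ₗ[R] F))

/-- An `S`-module `A` is FP-injective (absolutely pure) if `Ext¹(P, A) = 0` for every finitely
presented `S`-module `P`. -/
def FPInj (S : Type u) [Ring S] : ObjectProperty (ModuleCat.{u} S) :=
  fun A => ∀ P : ModuleCat.{u} S, Module.FinitePresentation S P →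
    Subsingleton (Abelian.Ext.{u} P A 1)

/-- The class of all injective `S`-modules. -/
def Inj (S : Type u) [Ring S] : ObjectProperty (ModuleCat.{u} S) :=
  fun I => Injective I

/-- An injective linear map `f : M → N` is pure if `0 → M → N → N / f(M) → 0` is pure exact:
every map from a finitely presented module to `N / f(M)` lifts to `N`. -/
def IsPureInjection {S : Type u} [Ring S] {M N : ModuleCat.{u} S} (f : M →ₗ[S] N) : Prop :=
  Function.Injective f ∧
    ∀ P : ModuleCat.{u} S, Module.FinitePresentation S P →
      ∀ g : P →ₗ[S] (N ⧸ LinearMap.range f), ∃ h : P →ₗ[S] N, (LinearMap.range f).mkQ ∘ₗ h = g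

/-- A class of `S`-modules is definable if it is closed under products, direct limits (of directed
systems of modules) and pure submodules.  The last condition includes closure under isomorphism. -/
structure IsDefinable {S : Type u} [Ring S] (C : ObjectProperty (ModuleCat.{u} S)) : Prop where
  pi_mem : ∀ (ι : Type u) (M : ι → ModuleCat.{u} S), (∀ i, C (M i)) →
    C (ModuleCat.of S (∀ i, M i))
  directLimit_mem : ∀ (ι : Type u) [Preorder ι] [IsDirectedOrder ι] [Nonempty ι] [DecidableEq ι]
    (M : ι → ModuleCat.{u} S) (f : ∀ i j, i ≤ j → M i →ₗ[S] M j)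
    [DirectedSystem (fun i => M i) (fun i j h => f i j h)], (∀ i, C (M i)) →
    C (ModuleCat.of S (Module.DirectLimit (fun i => M i) f))
  pureSubmodule_mem : ∀ (M N : ModuleCat.{u} S) (f : M →ₗ[S] N), IsPureInjection f → C N → C M

/-- The definable class generated by a class `C`: the smallest definable class containing it. -/
def definableClosure {S : Type u} [Ring S] (C : ObjectProperty (ModuleCat.{u} S)) :
    ObjectProperty (ModuleCat.{u} S) :=
  fun M => ∀ D : ObjectProperty (ModuleCat.{u} S), IsDefinable D → C ≤ D → D M

/-- `⟨Inj⟩`: the definable class generated by the injective `S`-modules. -/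
def DefInj (S : Type u) [Ring S] : ObjectProperty (ModuleCat.{u} S) :=
  definableClosure (Inj S)

/-! ### Acyclicity of complexes and relative Gorenstein modules -/

/-- `X` is `Hom(B, -)`-acyclic: `Hom(A, X)` is exact for every `A` in the class `B`. -/
def IsHomAcyclic {S : Type u} [Ring S] (B : ObjectProperty (ModuleCat.{u} S))
    (X : ChainComplex (ModuleCat.{u} S) ℤ) : Prop :=
  ∀ A : ModuleCat.{u} S, B A →
    (((preadditiveCoyoneda.obj (Opposite.op A)).mapHomologicalComplex _).obj X).Acyclic

/-- `X` is `B^⊗`-acyclic: `A ⊗_R X` is exact for every right module `A` in the class `B`. -/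
def IsTensorAcyclic {R : Type u} [Ring R] (B : ObjectProperty (ModuleCat.{u} Rᵐᵒᵖ))
    (X : ChainComplex (ModuleCat.{u} R) ℤ) : Prop :=
  ∀ A : ModuleCat.{u} Rᵐᵒᵖ, B A →
    (((tensorFunctor A).mapHomologicalComplex _).obj X).Acyclic

/-- `N` is Gorenstein `B`-injective: `N ≅ Z₀E` for some exact `Hom(B, -)`-acyclic complex `E` of
injectives. -/
def IsGorensteinInjective {S : Type u} [Ring S] (B : ObjectProperty (ModuleCat.{u} S))
    (N : ModuleCat.{u} S) : Prop :=
  ∃ E : ChainComplex (ModuleCat.{u} S) ℤ, E.Acyclic ∧ (∀ n, Injective (E.X n)) ∧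
    IsHomAcyclic B E ∧ Nonempty (N ≅ E.cycles 0)

/-- `N` is Ding injective: `N ≅ Z₀E` for some exact complex `E` of injectives such that
`Hom(A, E)` is exact for every FP-injective module `A`. -/
def IsDingInjective {S : Type u} [Ring S] (N : ModuleCat.{u} S) : Prop :=
  IsGorensteinInjective (FPInj S) N

/-- `N` is Gorenstein `B`-flat: `N ≅ Z₀F` for some exact `B^⊗`-acyclic complex `F` of flats. -/
def IsGorensteinFlatRel {R : Type u} [Ring R] (B : ObjectProperty (ModuleCat.{u} Rᵐᵒᵖ))
    (N : ModuleCat.{u} R) : Prop :=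
  ∃ F : ChainComplex (ModuleCat.{u} R) ℤ, F.Acyclic ∧ (∀ n, IsFlat (F.X n)) ∧
    IsTensorAcyclic B F ∧ Nonempty (N ≅ F.cycles 0)

/-- `N` is Gorenstein flat: `N ≅ Z₀F` for some exact complex `F` of flats such that `I ⊗_R F` is
exact for every injective right module `I`. -/
def IsGorensteinFlat {R : Type u} [Ring R] (N : ModuleCat.{u} R) : Prop :=
  IsGorensteinFlatRel (Inj Rᵐᵒᵖ) N

/-- `N` is projectively coresolved Gorenstein `B`-flat: `N ≅ Z₀P` for some exact `B^⊗`-acyclic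
complex `P` of projectives. -/
def IsPGFRel {R : Type u} [Ring R] (B : ObjectProperty (ModuleCat.{u} Rᵐᵒᵖ))
    (N : ModuleCat.{u} R) : Prop :=
  ∃ P : ChainComplex (ModuleCat.{u} R) ℤ, P.Acyclic ∧ (∀ n, Projective (P.X n)) ∧
    IsTensorAcyclic B P ∧ Nonempty (N ≅ P.cycles 0)

/-- `N` is projectively coresolved Gorenstein flat: `N ≅ Z₀P` for some exact complex `P` of
projectives such that `I ⊗_R P` is exact for every injective right module `I`. -/
def IsPGF {R : Type u} [Ring R] (N : ModuleCat.{u} R) : Prop :=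
  IsPGFRel (Inj Rᵐᵒᵖ) N

end DingModules

/-! The key is a description of `⟨Inj⟩`: each of its modules has the form `P / N`, where `N ≤ P ≤ I`
are pure submodules of an injective module `I`. It suffices that these quotients form a definable
class containing the injectives (`isDefinable_pureSubquotientOfInj`). Recording `P → M` as its graph
in `I × M` makes the closure properties statements about pairs and finite linear systems; the
delicate one is `pureSubquotientOfInj_directLimit`.

Let `0 → N → P → M → 0` be such a presentation. Pure submodules of injectives are FP-injective, so
if `E` consists of injectives and `Hom(A, E)` is exact for FP-injective `A`, it is exact for `N` and
`P`, hence for `M` (`hom_acyclic_of_shortExact`). Conversely, FP-injectives are pure in injectives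
and so lie in `⟨Inj⟩`.

For tensor products, exactness of `B ⊗ X` with `X` exact passes to pure submodules of `B`
(`tensor_acyclic_of_isEquationallyPure`), so from `I` to `N` and `P`. Since `N → P` is pure, it then
passes to `M` (`tensor_acyclic_of_exact`). The same complexes serve both classes, which gives the
statements on modules. -/

namespace DingModules

/-! ### Purity by systems of linear equations -/

section Purity

variable {S : Type u} [Ring S]

/-- A linear map `f : A → B` is pure in the sense of equations if every finite system of linear
equations with constants in `A` that is solvable in `B` is solvable in `A`. -/
def IsEquationallyPure {A B : Type u} [AddCommGroup A] [Module S A] [AddCommGroup B] [Module S B]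
    (f : A →ₗ[S] B) : Prop :=
  ∀ (m n : ℕ) (r : Fin m → Fin n → S) (b : Fin m → A) (x : Fin n → B),
    (∀ k, ∑ l, r k l • x l = f (b k)) → ∃ y : Fin n → A, ∀ k, ∑ l, r k l • y l = b k

variable {A B C : Type u} [AddCommGroup A] [Module S A] [AddCommGroup B] [Module S B]
  [AddCommGroup C] [Module S C]

theorem IsEquationallyPure.exists_solution {f : A →ₗ[S] B} (hf : IsEquationallyPure f)
    {κ ι : Type*} [Fintype κ] [Fintype ι] (r : κ → ι → S) (b : κ → A) (x : ι → B)
    (h : ∀ k, ∑ l, r k l • x l = f (b k)) : ∃ y : ι → A, ∀ k, ∑ l, r k l • y l = b k := by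
  let e := Fintype.equivFin κ
  let e' := Fintype.equivFin ι
  obtain ⟨y, hy⟩ := hf _ _ (fun k l => r (e.symm k) (e'.symm l)) (fun k => b (e.symm k))
    (fun l => x (e'.symm l)) fun k => by
      rw [← h, ← e'.symm.sum_comp fun l => r (e.symm k) l • x l]
  refine ⟨fun l => y (e' l), fun k => ?_⟩
  have := hy (e k)
  rw [← e'.sum_comp] at this
  simpa using this

theorem IsEquationallyPure.injective {f : A →ₗ[S] B} (hf : IsEquationallyPure f) :
    Function.Injective f := by
  rw [injective_iff_map_eq_zero]
  intro a ha
  -- One equation in no unknowns, reading `0 = f a`.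
  obtain ⟨y, hy⟩ := hf 1 0 (fun _ _ => 0) (fun _ => a) (fun _ => 0) (by simp [ha])
  simpa using (hy 0).symm

theorem IsEquationallyPure.of_comp {f : A →ₗ[S] B} {g : B →ₗ[S] C}
    (h : IsEquationallyPure (g ∘ₗ f)) : IsEquationallyPure f := fun m n r b x hx =>
  h m n r b (fun l => g (x l)) fun k => by simp [← hx, map_sum]

/-- The coefficient rows present a module `S^n / K`, and a solution `x` in `N` induces a map from it
to `N / f(M)`. A lift to `N` solves the homogeneous system; subtracting it from `x` leaves a
solution in `f(M)`. -/
theorem IsPureInjection.isEquationallyPure {M N : ModuleCat.{u} S} {f : M →ₗ[S] N}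
    (hf : IsPureInjection f) : IsEquationallyPure f := by
  intro m n r b x hx
  let K : Submodule S (Fin n → S) := Submodule.span S (Set.range r)
  have hK : K ≤ LinearMap.ker
      ((LinearMap.range f).mkQ ∘ₗ Fintype.linearCombination S x) := by
    refine Submodule.span_le.2 ?_
    rintro _ ⟨k, rfl⟩
    simp [Fintype.linearCombination_apply, hx]
  have hP : Module.FinitePresentation S ((Fin n → S) ⧸ K) :=
    Module.finitePresentation_of_surjective K.mkQ K.mkQ_surjective
      (by rw [Submodule.ker_mkQ]; exact Submodule.fg_span (Set.finite_range r))
  obtain ⟨h, hh⟩ := hf.2 (ModuleCat.of S ((Fin n → S) ⧸ K)) hP (K.liftQ _ hK)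
  let h' : (Fin n → S) →ₗ[S] N := h ∘ₗ K.mkQ
  have hy : ∀ l, ∃ y, f y = x l - h' (Pi.single l 1) := fun l => by
    rw [← LinearMap.mem_range, ← Submodule.Quotient.mk_eq_zero, Submodule.Quotient.mk_sub,
      sub_eq_zero]
    have := LinearMap.congr_fun hh (K.mkQ (Pi.single l 1))
    simpa [Fintype.linearCombination_apply_single, h'] using this.symm
  choose y hy using hy
  refine ⟨y, fun k => hf.1 ?_⟩
  have hr : h' (r k) = 0 := by
    have : K.mkQ (r k) = 0 := by
      simpa [K] using Submodule.subset_span (R := S) (Set.mem_range_self (f := r) k)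
    simp only [h', LinearMap.comp_apply]
    rw [this, map_zero]
  have hlc : Fintype.linearCombination S (fun l => h' (Pi.single l 1)) = h' :=
    LinearMap.pi_ext' fun l => LinearMap.ext_ring (by
      simp [Fintype.linearCombination_apply_single])
  have hsum : ∑ l, r k l • h' (Pi.single l 1) = h' (r k) := LinearMap.congr_fun hlc (r k)
  simp only [map_sum, map_smul, hy, smul_sub, Finset.sum_sub_distrib, hx, hsum, hr, sub_zero]

/-- Lift the images of the generators of `P` to elements `x` of `N`. The relations of `P` evaluated
at `x` land in `f(M)`; a solution `y` of that system in `M` makes `x - f y` satisfy the relations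
exactly. -/
theorem IsEquationallyPure.isPureInjection {M N : ModuleCat.{u} S} {f : M →ₗ[S] N}
    (hf : IsEquationallyPure f) : IsPureInjection f := by
  refine ⟨hf.injective, fun P hP g => ?_⟩
  obtain ⟨n, m, p, q, hp, hpq⟩ := Module.FinitePresentation.exists_fin' S P
  choose x hx using fun l : Fin n => (LinearMap.range f).mkQ_surjective (g (p (Pi.single l 1)))
  have hmk : (LinearMap.range f).mkQ ∘ₗ Fintype.linearCombination S x = g ∘ₗ p := by
    refine LinearMap.pi_ext' fun l => LinearMap.ext_ring ?_
    simpa [Fintype.linearCombination_apply_single] using hx l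
  have hb : ∀ k, ∃ b, f b = Fintype.linearCombination S x (q (Pi.single k 1)) := fun k => by
    rw [← LinearMap.mem_range, ← Submodule.Quotient.mk_eq_zero]
    have := LinearMap.congr_fun hmk (q (Pi.single k 1))
    simpa [hpq.apply_apply_eq_zero] using this
  choose b hb using hb
  obtain ⟨y, hy⟩ := hf m n (fun k => q (Pi.single k 1)) b x fun k => by
    rw [hb, Fintype.linearCombination_apply]
  let φ : (Fin n → S) →ₗ[S] N :=
    Fintype.linearCombination S x - f ∘ₗ Fintype.linearCombination S y
  have hφ : φ ∘ₗ q = 0 := by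
    refine LinearMap.pi_ext' fun k => LinearMap.ext_ring ?_
    have : Fintype.linearCombination S y (q (Pi.single k 1)) = b k := by
      rw [Fintype.linearCombination_apply, hy]
    simp [φ, this, hb]
  have hker : LinearMap.ker p ≤ LinearMap.ker φ := by
    intro v hv
    obtain ⟨w, rfl⟩ := (hpq v).1 hv
    exact LinearMap.congr_fun hφ w
  refine ⟨(LinearMap.ker p).liftQ φ hker ∘ₗ
    (p.quotKerEquivOfSurjective hp).symm.toLinearMap, ?_⟩
  ext z
  obtain ⟨v, rfl⟩ := hp z
  have h1 : (p.quotKerEquivOfSurjective hp).symm (p v) = (LinearMap.ker p).mkQ v := by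
    rw [LinearEquiv.symm_apply_eq]; rfl
  have h2 := LinearMap.congr_fun hmk v
  have h3 : (LinearMap.range f).mkQ (f (Fintype.linearCombination S y v)) = 0 := by simp
  simp only [LinearMap.comp_apply, LinearEquiv.coe_coe] at h2 ⊢
  rw [h1]
  change (LinearMap.range f).mkQ (φ v) = _
  rw [← h2]
  simp only [φ, LinearMap.sub_apply, LinearMap.comp_apply, map_sub, h3, sub_zero]

end Purity

/-! ### FP-injective modules and pure submodules of injective modules -/

section FPInjective

variable {S : Type u} [Ring S]

/-- The short exact sequence `0 → A → N → N / f(A) → 0` of an injective linear map `f`. -/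
theorem shortExact_mkQ {A N : ModuleCat.{u} S} (f : A →ₗ[S] N) (hf : Function.Injective f) :
    (ShortComplex.mk (ModuleCat.ofHom f) (ModuleCat.ofHom (LinearMap.range f).mkQ)
      (by ext; simp)).ShortExact where
  exact := by
    rw [ShortComplex.moduleCat_exact_iff_range_eq_ker]
    exact (LinearMap.range f).ker_mkQ.symm
  mono_f := (ModuleCat.mono_iff_injective _).2 hf
  epi_g := (ModuleCat.epi_iff_surjective _).2 (LinearMap.range f).mkQ_surjective

/-- As `Ext¹(P, I) = 0`, each class in `Ext¹(P, A)` is the connecting image of a map `P → I / A`.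
That map lifts to `I`, so its connecting image vanishes. -/
theorem IsPureInjection.fpInj {A I : ModuleCat.{u} S} [Injective I] {f : A →ₗ[S] I}
    (hf : IsPureInjection f) : FPInj S A := by
  intro P hP
  have hS := shortExact_mkQ f hf.1
  refine subsingleton_of_forall_eq 0 fun e => ?_
  obtain ⟨e', rfl⟩ := Abelian.Ext.covariant_sequence_exact₁ P hS e
    (Abelian.Ext.eq_zero_of_injective _) (zero_add 1)
  obtain ⟨g, rfl⟩ := Abelian.Ext.homEquiv₀.symm.surjective e'
  obtain ⟨h, hh⟩ := hf.2 P hP g.hom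
  have hg : g = ModuleCat.ofHom h ≫ ModuleCat.ofHom (LinearMap.range f).mkQ := by
    ext1
    exact hh.symm
  rw [Abelian.Ext.homEquiv₀_symm_apply, hg, ← Abelian.Ext.mk₀_comp_mk₀,
    Abelian.Ext.comp_assoc_of_second_deg_zero]
  erw [hS.comp_extClass]
  simp

/-- The obstruction to lifting a map `P → N / A` to `N` lies in `Ext¹(P, A)`. -/
theorem FPInj.isPureInjection {A : ModuleCat.{u} S} (hA : FPInj S A) {N : ModuleCat.{u} S}
    {f : A →ₗ[S] N} (hf : Function.Injective f) : IsPureInjection f := by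
  refine ⟨hf, fun P hP g => ?_⟩
  have hS := shortExact_mkQ f hf
  have := hA P hP
  obtain ⟨e, he⟩ := Abelian.Ext.covariant_sequence_exact₃ P hS
    (Abelian.Ext.mk₀ (ModuleCat.ofHom g)) (zero_add 1) (Subsingleton.elim _ _)
  obtain ⟨h, rfl⟩ := Abelian.Ext.homEquiv₀.symm.surjective e
  rw [Abelian.Ext.homEquiv₀_symm_apply, Abelian.Ext.mk₀_comp_mk₀] at he
  exact ⟨h.hom, congrArg ModuleCat.Hom.hom ((Abelian.Ext.mk₀_bijective _ _).1 he)⟩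

theorem fpInj_le_defInj : FPInj S ≤ DefInj S := by
  intro A hA D hD hInj
  refine hD.pureSubmodule_mem A (Injective.under A) (Injective.ι A).hom
    (hA.isPureInjection ?_) (hInj _ (inferInstanceAs (Injective (Injective.under A))))
  exact (ModuleCat.mono_iff_injective _).1 inferInstance

theorem injective_pi {ι : Type u} (I : ι → ModuleCat.{u} S) (hI : ∀ i, Injective (I i)) :
    Injective (ModuleCat.of S (∀ i, I i)) := by
  have : ∀ i, Module.Injective S (I i) := fun i =>
    (Module.injective_iff_injective_object S (I i)).2 (hI i)
  exact Module.injective_object_of_injective_module S _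

end FPInjective

/-! ### Pure subquotients of injective modules -/

section PureSubquotient

variable {S : Type u} [Ring S]

/-- `G ≤ I × M` is the graph of a surjective linear map from a pure submodule of `I` onto `M`
whose kernel is a pure submodule of `I`. -/
structure IsPurePartialSurjection {I M : Type u} [AddCommGroup I] [Module S I] [AddCommGroup M]
    [Module S M] (G : Submodule S (I × M)) : Prop where
  eq_zero : ∀ m, (0, m) ∈ G → m = 0
  total : ∀ m, ∃ x, (x, m) ∈ G
  pure_domain : ∀ (p n : ℕ) (r : Fin p → Fin n → S) (x : Fin n → I) (c : Fin p → M),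
    (∀ k, (∑ l, r k l • x l, c k) ∈ G) →
      ∃ (y : Fin n → I) (m : Fin n → M), (∀ l, (y l, m l) ∈ G) ∧
        ∀ k, ∑ l, r k l • y l = ∑ l, r k l • x l
  pure_ker : ∀ (p n : ℕ) (r : Fin p → Fin n → S) (x : Fin n → I),
    (∀ k, (∑ l, r k l • x l, (0 : M)) ∈ G) →
      ∃ y : Fin n → I, (∀ l, (y l, (0 : M)) ∈ G) ∧ ∀ k, ∑ l, r k l • y l = ∑ l, r k l • x l

/-- The modules of the form `P / N` for an injective module `I` and pure submodules `N ≤ P ≤ I`. -/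
def PureSubquotientOfInj (S : Type u) [Ring S] : ObjectProperty (ModuleCat.{u} S) := fun M =>
  ∃ (I : ModuleCat.{u} S) (G : Submodule S (I × M)), Injective I ∧ IsPurePartialSurjection G

namespace IsPurePartialSurjection

variable {I M : Type u} [AddCommGroup I] [Module S I] [AddCommGroup M] [Module S M]
  {G : Submodule S (I × M)}

theorem sum_mem {n : ℕ} (r : Fin n → S) {x : Fin n → I} {m : Fin n → M}
    (h : ∀ l, (x l, m l) ∈ G) : (∑ l, r l • x l, ∑ l, r l • m l) ∈ G := by
  have := G.sum_mem fun l (_ : l ∈ Finset.univ) => G.smul_mem (r l) (h l)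
  convert! this
  · simp [Prod.fst_sum]
  · simp [Prod.snd_sum]

theorem snd_unique (hG : IsPurePartialSurjection G) {x : I} {m m' : M} (h : (x, m) ∈ G)
    (h' : (x, m') ∈ G) : m = m' :=
  sub_eq_zero.1 (hG.eq_zero _ (by simpa using G.sub_mem h h'))

/-- A system that is solvable in `I`, with constants in the domain of the partial map `G`, has a
solution in the domain that lies over a prescribed solution of the image system. -/
theorem exists_lift (hG : IsPurePartialSurjection G) {p n : ℕ} (r : Fin p → Fin n → S)
    (x : Fin n → I) (m : Fin n → M)
    (h : ∀ k, (∑ l, r k l • x l, ∑ l, r k l • m l) ∈ G) :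
    ∃ y : Fin n → I, (∀ l, (y l, m l) ∈ G) ∧ ∀ k, ∑ l, r k l • y l = ∑ l, r k l • x l := by
  choose z hz using fun l => hG.total (m l)
  -- Subtracting any lift `z` of `m` leaves a system with constants in the kernel, where purity of
  -- the kernel applies.
  obtain ⟨w, hw, hw'⟩ := hG.pure_ker p n r (fun l => x l - z l) fun k => by
    simpa [smul_sub] using G.sub_mem (h k) (sum_mem (r k) hz)
  refine ⟨fun l => z l + w l, fun l => by simpa using G.add_mem (hz l) (hw l), fun k => ?_⟩
  simp [smul_add, Finset.sum_add_distrib, hw', smul_sub]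

end IsPurePartialSurjection

theorem inj_le_pureSubquotientOfInj : Inj S ≤ PureSubquotientOfInj S := by
  intro I hI
  refine ⟨I, LinearMap.graph LinearMap.id, hI, ?_, ?_, ?_, ?_⟩
  · simp
  · simp
  · intro p n r x c _
    exact ⟨x, x, by simp, by simp⟩
  · intro p n r x h
    refine ⟨0, by simp, fun k => ?_⟩
    simpa using h k

theorem pureSubquotientOfInj_pi (ι : Type u) (M : ι → ModuleCat.{u} S)
    (hM : ∀ i, PureSubquotientOfInj S (M i)) :
    PureSubquotientOfInj S (ModuleCat.of S (∀ i, M i)) := by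
  choose I G hI hG using hM
  let G' : Submodule S ((∀ i, I i) × (∀ i, M i)) :=
    ⨅ i, (G i).comap ((LinearMap.proj i).prodMap (LinearMap.proj i))
  have hG' : ∀ x m, (x, m) ∈ G' ↔ ∀ i, (x i, m i) ∈ G i := by simp [G']
  refine ⟨ModuleCat.of S (∀ i, I i), G', injective_pi I hI, ?_, ?_, ?_, ?_⟩
  · intro m hm
    funext i
    exact (hG i).eq_zero _ ((hG' _ _).1 hm i)
  · intro m
    choose x hx using fun i => (hG i).total (m i)
    exact ⟨x, (hG' _ _).2 hx⟩
  · intro p n r x c h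
    choose y m hym hy using fun i => (hG i).pure_domain p n r (fun l => x l i) (fun k => c k i)
      fun k => by simpa using (hG' _ _).1 (h k) i
    refine ⟨fun l i => y i l, fun l i => m i l, fun l => (hG' _ _).2 fun i => hym i l,
      fun k => funext fun i => ?_⟩
    simpa using hy i k
  · intro p n r x h
    choose y hym hy using fun i => (hG i).pure_ker p n r (fun l => x l i)
      fun k => by
        have := (hG' _ _).1 (h k) i
        rw [Finset.sum_apply] at this
        exact this
    refine ⟨fun l i => y i l, fun l => (hG' _ _).2 fun i => hym i l,
      fun k => funext fun i => ?_⟩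
    simpa using hy i k

/-- The preimage of `M` in the domain is used, with the same kernel. For its purity, push a solution
down to `N`, replace it by one in `M`, and lift that back with `exists_lift`. -/
theorem PureSubquotientOfInj.of_isPureInjection {M N : ModuleCat.{u} S} {f : M →ₗ[S] N}
    (hf : IsPureInjection f) (hN : PureSubquotientOfInj S N) : PureSubquotientOfInj S M := by
  obtain ⟨I, G, hI, hG⟩ := hN
  refine ⟨I, G.comap (LinearMap.id.prodMap f), hI, ?_, ?_, ?_, ?_⟩
  · intro m hm
    exact hf.1 ((hG.eq_zero _ hm).trans (map_zero f).symm)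
  · exact fun m => hG.total (f m)
  · intro p n r x c h
    obtain ⟨y, m, hym, hy⟩ := hG.pure_domain p n r x (fun k => f (c k)) h
    have hm : ∀ k, ∑ l, r k l • m l = f (c k) := fun k =>
      hG.snd_unique (IsPurePartialSurjection.sum_mem (r k) hym) (by rw [hy k]; exact h k)
    obtain ⟨m', hm'⟩ := hf.isEquationallyPure p n r c m hm
    obtain ⟨z, hz, hz'⟩ := hG.exists_lift r x (fun l => f (m' l)) fun k => by
      have : ∑ l, r k l • f (m' l) = f (c k) := by simp [← hm' k]
      rw [this]; exact h k
    exact ⟨z, m', hz, hz'⟩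
  · intro p n r x h
    obtain ⟨y, hy, hy'⟩ := hG.pure_ker p n r x fun k => by simpa using h k
    exact ⟨y, fun l => by simpa using hy l, hy'⟩

/-- Inside `∏ I i`, take the families with every coordinate in its domain that from some index on
lie over the images of a single `a`; send such a family to the class of `a`. The condition on all
coordinates is what lets systems be solved at indices outside the tail. -/
theorem pureSubquotientOfInj_directLimit (ι : Type u) [Preorder ι] [IsDirectedOrder ι]
    [Nonempty ι] [DecidableEq ι] (M : ι → ModuleCat.{u} S) (f : ∀ i j, i ≤ j → M i →ₗ[S] M j)
    [DirectedSystem (fun i => M i) (fun i j h => f i j h)]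
    (hM : ∀ i, PureSubquotientOfInj S (M i)) :
    PureSubquotientOfInj S (ModuleCat.of S (Module.DirectLimit (fun i => M i) f)) := by
  choose I G hI hG using hM
  have hff : ∀ {i j k} (hij : i ≤ j) (hjk : j ≤ k) (a : M i),
      f j k hjk (f i j hij a) = f i k (hij.trans hjk) a := fun hij hjk a =>
    DirectedSystem.map_map (f := fun i j h => f i j h) hij hjk a
  let of := Module.DirectLimit.of S ι (fun i => M i) f
  -- `Over x m i a`: from `i` on, `x` lies over the family that `a` generates
  let Over (x : ∀ i, I i) (i : ι) (a : M i) : Prop := ∀ j (h : i ≤ j), (x j, f i j h a) ∈ G j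
  have over_mono : ∀ {x i j a} (h : i ≤ j), Over x i a → Over x j (f i j h a) := by
    intro x i j a h hx k hk
    rw [hff]
    exact hx k _
  let G' : Submodule S ((∀ i, I i) × Module.DirectLimit (fun i => M i) f) :=
    { carrier := {z | (∀ i, ∃ a, (z.1 i, a) ∈ G i) ∧ ∃ i a, of i a = z.2 ∧ Over z.1 i a}
      zero_mem' := ⟨fun i => ⟨0, (G i).zero_mem⟩, Classical.arbitrary ι, 0, map_zero _,
        fun j h => by rw [map_zero]; exact (G j).zero_mem⟩
      add_mem' := by
        rintro ⟨x, _⟩ ⟨x', _⟩ ⟨hx, i, a, rfl, ha⟩ ⟨hx', i', a', rfl, ha'⟩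
        refine ⟨fun j => ?_, ?_⟩
        · obtain ⟨b, hb⟩ := hx j
          obtain ⟨b', hb'⟩ := hx' j
          exact ⟨b + b', (G j).add_mem hb hb'⟩
        · obtain ⟨k, hk, hk'⟩ := exists_ge_ge i i'
          refine ⟨k, f i k hk a + f i' k hk' a', ?_, fun j h => ?_⟩
          · simp only [of, map_add, Module.DirectLimit.of_f]; rfl
          · rw [map_add]
            exact (G j).add_mem (over_mono hk ha j h) (over_mono hk' ha' j h)
      smul_mem' := by
        rintro s ⟨x, _⟩ ⟨hx, i, a, rfl, ha⟩
        refine ⟨fun j => ?_, i, s • a, map_smul _ _ _, fun j h => ?_⟩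
        · obtain ⟨b, hb⟩ := hx j
          exact ⟨s • b, (G j).smul_mem s hb⟩
        · rw [map_smul]
          exact (G j).smul_mem s (ha j h) }
  have exists_common : ∀ {p : ℕ} (i : Fin p → ι), ∃ j, ∀ k, i k ≤ j := fun i =>
    (Set.finite_range i).bddAbove.imp fun j hj k => hj ⟨k, rfl⟩
  refine ⟨ModuleCat.of S (∀ i, I i), G', injective_pi I hI, ?_, ?_, ?_, ?_⟩
  · rintro _ ⟨-, i, a, rfl, ha⟩
    have := (hG i).eq_zero _ (ha i le_rfl)
    rw [DirectedSystem.map_self (f := fun i j h => f i j h)] at this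
    rw [this, map_zero]
  · intro m
    obtain ⟨i, a, rfl⟩ := Module.DirectLimit.exists_of m
    -- Off the tail `i ≤ j` the coordinate is irrelevant to the class and is set to `0`.
    have : ∀ j, ∃ x, (∃ b, (x, b) ∈ G j) ∧ ∀ h : i ≤ j, (x, f i j h a) ∈ G j := by
      intro j
      by_cases h : i ≤ j
      · obtain ⟨x, hx⟩ := (hG j).total (f i j h a)
        exact ⟨x, ⟨_, hx⟩, fun _ => hx⟩
      · exact ⟨0, ⟨0, (G j).zero_mem⟩, fun h' => absurd h' h⟩
    choose x hx hx' using this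
    exact ⟨x, hx, i, a, rfl, hx'⟩
  · intro p n r x c h
    choose hb i a hia ha using h
    obtain ⟨i₀, hi₀⟩ := exists_common i
    choose b hb using hb
    -- Stage `i₀` alone fixes the images `e` of the unknowns; the later coordinates are then lifted
    -- over the images of this `e`, so that they are compatible.
    obtain ⟨y, e, hye, hy⟩ := (hG i₀).pure_domain p n r (fun l => x l i₀) (fun k => b k i₀)
      fun k => by simpa using hb k i₀
    have he : ∀ k, ∑ l, r k l • e l = f (i k) i₀ (hi₀ k) (a k) := fun k =>
      (hG i₀).snd_unique (IsPurePartialSurjection.sum_mem (r k) hye)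
        (by rw [hy k]; simpa using ha k i₀ (hi₀ k))
    have key : ∀ j, ∃ z : Fin n → I j, (∀ l, ∃ b, (z l, b) ∈ G j) ∧
        (∀ (h : i₀ ≤ j) l, (z l, f i₀ j h (e l)) ∈ G j) ∧
        ∀ k, ∑ l, r k l • z l = ∑ l, r k l • x l j := by
      intro j
      by_cases h : i₀ ≤ j
      · obtain ⟨z, hz, hz'⟩ := (hG j).exists_lift r (fun l => x l j) (fun l => f i₀ j h (e l))
          fun k => by
            have := ha k j ((hi₀ k).trans h)
            rw [← hff (hi₀ k) h, ← he k] at this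
            simpa using this
        exact ⟨z, fun l => ⟨_, hz l⟩, fun _ => hz, hz'⟩
      · obtain ⟨z, m, hzm, hz⟩ := (hG j).pure_domain p n r (fun l => x l j) (fun k => b k j)
          fun k => by simpa using hb k j
        exact ⟨z, fun l => ⟨_, hzm l⟩, fun h' => absurd h' h, hz⟩
    choose z hz hz' hz'' using key
    refine ⟨fun l j => z j l, fun l => of i₀ (e l),
      fun l => ⟨fun j => hz j l, i₀, e l, rfl, fun j h => hz' j h l⟩, fun k => funext fun j => ?_⟩
    simpa using hz'' j k
  · intro p n r x h
    choose hb i a hia ha using h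
    -- Constants that vanish in the limit vanish at a finite stage. Kernel purity applies beyond a
    -- common such stage, domain purity elsewhere.
    have hz : ∀ k, ∃ j, ∃ h : i k ≤ j, f (i k) j h (a k) = 0 := fun k =>
      Module.DirectLimit.of.zero_exact (hia k)
    choose i' hi' ha' using hz
    obtain ⟨i₀, hi₀⟩ := exists_common i'
    choose b hb using hb
    have key : ∀ j, ∃ z : Fin n → I j, (∀ l, ∃ b, (z l, b) ∈ G j) ∧
        (i₀ ≤ j → ∀ l, (z l, (0 : M j)) ∈ G j) ∧
        ∀ k, ∑ l, r k l • z l = ∑ l, r k l • x l j := by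
      intro j
      by_cases h : i₀ ≤ j
      · obtain ⟨z, hz, hz'⟩ := (hG j).pure_ker p n r (fun l => x l j) fun k => by
          have := ha k j ((hi' k).trans ((hi₀ k).trans h))
          rw [← hff (hi' k) ((hi₀ k).trans h), ha' k, map_zero] at this
          simpa using this
        exact ⟨z, fun l => ⟨_, hz l⟩, fun _ => hz, hz'⟩
      · obtain ⟨z, m, hzm, hz⟩ := (hG j).pure_domain p n r (fun l => x l j) (fun k => b k j)
          fun k => by simpa using hb k j
        exact ⟨z, fun l => ⟨_, hzm l⟩, fun h' => absurd h' h, hz⟩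
    choose z hz hz' hz'' using key
    refine ⟨fun l j => z j l, fun l => ⟨fun j => hz j l, i₀, 0, map_zero _, fun j h => ?_⟩,
      fun k => funext fun j => ?_⟩
    · rw [map_zero]
      exact hz' j h l
    · simpa using hz'' j k

theorem isDefinable_pureSubquotientOfInj : IsDefinable (PureSubquotientOfInj S) where
  pi_mem := pureSubquotientOfInj_pi
  directLimit_mem := pureSubquotientOfInj_directLimit
  pureSubmodule_mem _ _ _ hf hN := hN.of_isPureInjection hf

theorem defInj_le_pureSubquotientOfInj : DefInj S ≤ PureSubquotientOfInj S := fun _ hM =>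
  hM _ isDefinable_pureSubquotientOfInj inj_le_pureSubquotientOfInj

/-- Here `P` is the graph itself and `N` the kernel of its projection to `M`; both embed purely in
`I` by the first coordinate. -/
theorem PureSubquotientOfInj.exists_exact {M : ModuleCat.{u} S} (hM : PureSubquotientOfInj S M) :
    ∃ (I P N : ModuleCat.{u} S) (j : N →ₗ[S] P) (g : P →ₗ[S] M) (i : P →ₗ[S] I),
      Injective I ∧ Function.Surjective g ∧ Function.Exact j g ∧ IsEquationallyPure i ∧
        IsEquationallyPure (i ∘ₗ j) := by
  obtain ⟨I, G, hI, hG⟩ := hM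
  let g : G →ₗ[S] M := LinearMap.snd S I M ∘ₗ G.subtype
  let i : G →ₗ[S] I := LinearMap.fst S I M ∘ₗ G.subtype
  have hi : Function.Injective i := by
    rintro ⟨⟨x, m⟩, h⟩ ⟨⟨x', m'⟩, h'⟩ (rfl : x = x')
    simp [hG.snd_unique h h']
  refine ⟨I, ModuleCat.of S G, ModuleCat.of S (LinearMap.ker g), (LinearMap.ker g).subtype, g, i,
    hI, fun m => ?_, fun x => ?_, fun p n r b x h => ?_, fun p n r b x h => ?_⟩
  · obtain ⟨x, hx⟩ := hG.total m
    exact ⟨⟨(x, m), hx⟩, rfl⟩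
  · simp
  · obtain ⟨y, m, hym, hy⟩ := hG.pure_domain p n r x (fun k => (b k).1.2) fun k => by
      rw [h k]; exact (b k).2
    refine ⟨fun l => ⟨(y l, m l), hym l⟩, fun k => hi ?_⟩
    rw [map_sum, ← h k, ← hy k]
    exact Finset.sum_congr rfl fun l _ => map_smul _ _ _
  · obtain ⟨y, hy, hy'⟩ := hG.pure_ker p n r x fun k => by
      rw [h k]
      have h0 : (b k).1.1.2 = 0 := (b k).2
      rw [← h0]
      exact (b k).1.2
    refine ⟨fun l => ⟨⟨(y l, 0), hy l⟩, rfl⟩, fun k => Subtype.ext (hi ?_)⟩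
    refine Eq.trans ?_ ((hy' k).trans (h k))
    change (i ∘ₗ (LinearMap.ker g).subtype) (∑ l, _) = _
    rw [map_sum]
    exact Finset.sum_congr rfl fun l _ => map_smul _ _ _

end PureSubquotient

/-! ### Exactness properties of the tensor product over a noncommutative ring -/

namespace BalancedTensor

variable {R : Type u} [Ring R]

section

variable {M M' M'' N N' N'' : Type u} [AddCommGroup M] [Module Rᵐᵒᵖ M]
  [AddCommGroup M'] [Module Rᵐᵒᵖ M'] [AddCommGroup M''] [Module Rᵐᵒᵖ M'']
  [AddCommGroup N] [Module R N] [AddCommGroup N'] [Module R N'] [AddCommGroup N''] [Module R N'']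

/-- The pure tensor `m ⊗ n` in `M ⊗_R N`. -/
def tmul (m : M) (n : N) : BalancedTensor R M N := QuotientAddGroup.mk (m ⊗ₜ[ℤ] n)

theorem tmul_add (m : M) (n n' : N) : tmul (R := R) m (n + n') = tmul m n + tmul m n' := by
  simp only [tmul, TensorProduct.tmul_add]; rfl

theorem add_tmul (m m' : M) (n : N) : tmul (R := R) (m + m') n = tmul m n + tmul m' n := by
  simp only [tmul, TensorProduct.add_tmul]; rfl

theorem smul_tmul (m : M) (r : R) (n : N) :
    tmul (R := R) (MulOpposite.op r • m) n = tmul m (r • n) := by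
  refine (QuotientAddGroup.eq_iff_sub_mem).2 (AddSubgroup.subset_closure ⟨m, r, n, rfl⟩)

@[simp]
theorem map_tmul (f : M →ₗ[Rᵐᵒᵖ] M') (g : N →ₗ[R] N') (m : M) (n : N) :
    map f g (tmul m n) = tmul (f m) (g n) := rfl

@[elab_as_elim]
theorem induction_on {p : BalancedTensor R M N → Prop} (t : BalancedTensor R M N) (zero : p 0)
    (tmul : ∀ m n, p (tmul m n)) (add : ∀ x y, p x → p y → p (x + y)) : p t := by
  obtain ⟨t, rfl⟩ := QuotientAddGroup.mk_surjective t
  induction t with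
  | zero => exact zero
  | tmul m n => exact tmul m n
  | add x y hx hy => exact add _ _ hx hy

theorem exists_sum_tmul (t : BalancedTensor R M N) :
    ∃ (n : ℕ) (a : Fin n → M) (b : Fin n → N), t = ∑ j, tmul (a j) (b j) := by
  induction t using induction_on with
  | zero => exact ⟨0, Fin.elim0, Fin.elim0, by simp⟩
  | tmul m n => exact ⟨1, fun _ => m, fun _ => n, by simp⟩
  | add x y hx hy =>
    obtain ⟨n, a, b, rfl⟩ := hx
    obtain ⟨n', a', b', rfl⟩ := hy
    exact ⟨n + n', Fin.append a a', Fin.append b b', by simp [Fin.sum_univ_add]⟩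

theorem map_map (f : M →ₗ[Rᵐᵒᵖ] M') (f' : M' →ₗ[Rᵐᵒᵖ] M'') (g : N →ₗ[R] N') (g' : N' →ₗ[R] N'')
    (t : BalancedTensor R M N) : map f' g' (map f g t) = map (f' ∘ₗ f) (g' ∘ₗ g) t := by
  induction t using induction_on with
  | zero => simp
  | tmul m n => simp
  | add x y hx hy => simp only [map_add, hx, hy]

theorem map_zero_right (f : M →ₗ[Rᵐᵒᵖ] M') (t : BalancedTensor R M N) :
    map f (0 : N →ₗ[R] N') t = 0 := by
  induction t using induction_on with
  | zero => simp
  | tmul m n => rw [map_tmul, LinearMap.zero_apply, tmul, TensorProduct.tmul_zero]; rfl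
  | add x y hx hy => simp only [map_add, hx, hy, add_zero]

theorem map_zero_left (g : N →ₗ[R] N') (t : BalancedTensor R M N) :
    map (0 : M →ₗ[Rᵐᵒᵖ] M') g t = 0 := by
  induction t using induction_on with
  | zero => simp
  | tmul m n => rw [map_tmul, LinearMap.zero_apply, tmul, TensorProduct.zero_tmul]; rfl
  | add x y hx hy => simp only [map_add, hx, hy, add_zero]

theorem map_id_comm (f : M →ₗ[Rᵐᵒᵖ] M') (g : N →ₗ[R] N') (t : BalancedTensor R M N) :
    map f (LinearMap.id : N' →ₗ[R] N') (map LinearMap.id g t) =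
      map LinearMap.id g (map f LinearMap.id t) := by
  simp [map_map]

theorem map_surjective {f : M →ₗ[Rᵐᵒᵖ] M'} {g : N →ₗ[R] N'} (hf : Function.Surjective f)
    (hg : Function.Surjective g) : Function.Surjective (map f g) := by
  intro t
  induction t using induction_on with
  | zero => exact ⟨0, map_zero _⟩
  | tmul m n =>
    obtain ⟨m, rfl⟩ := hf m
    obtain ⟨n, rfl⟩ := hg n
    exact ⟨tmul m n, rfl⟩
  | add x y hx hy =>
    obtain ⟨x, rfl⟩ := hx
    obtain ⟨y, rfl⟩ := hy
    exact ⟨x + y, map_add _ _ _⟩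

/-- For surjective `f` and `g`, every element of the kernel of `f ⊗_R g` is represented by an
element of the kernel of `f ⊗_ℤ g`. -/
theorem exists_rep_of_map_eq_zero {f : M →ₗ[Rᵐᵒᵖ] M'} {g : N →ₗ[R] N'}
    (hf : Function.Surjective f) (hg : Function.Surjective g) {t : BalancedTensor R M N}
    (ht : map f g t = 0) : ∃ s : M ⊗[ℤ] N, intTensorMap f g s = 0 ∧ QuotientAddGroup.mk s = t := by
  obtain ⟨t, rfl⟩ := QuotientAddGroup.mk_surjective t
  -- Surjectivity lifts each balancing relation, so `t` can be corrected by an element that is zero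
  -- in `M ⊗_R N`.
  have hle : balancingSubgroup R M' N' ≤ (balancingSubgroup R M N).map (intTensorMap f g) := by
    refine (AddSubgroup.closure_le _).2 ?_
    rintro _ ⟨m, r, n, rfl⟩
    obtain ⟨m, rfl⟩ := hf m
    obtain ⟨n, rfl⟩ := hg n
    exact ⟨_, AddSubgroup.subset_closure ⟨m, r, n, rfl⟩, by simp [map_sub]⟩
  obtain ⟨s, hs, hst⟩ := hle ((QuotientAddGroup.eq_zero_iff _).1 ht)
  refine ⟨t - s, by rw [map_sub, hst, sub_self], ?_⟩
  rw [QuotientAddGroup.mk_sub, (QuotientAddGroup.eq_zero_iff s).2 hs, sub_zero]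

theorem exact_map_id_left {f : N →ₗ[R] N'} {g : N' →ₗ[R] N''} (h : Function.Exact f g)
    (hg : Function.Surjective g) {t : BalancedTensor R M N'}
    (ht : map (LinearMap.id : M →ₗ[Rᵐᵒᵖ] M) g t = 0) :
    ∃ s : BalancedTensor R M N, map LinearMap.id f s = t := by
  obtain ⟨t, ht₀, rfl⟩ := exists_rep_of_map_eq_zero (f := LinearMap.id) Function.surjective_id hg ht
  obtain ⟨s, hs⟩ := (lTensor_exact M (f := f.toAddMonoidHom.toIntLinearMap)
    (g := g.toAddMonoidHom.toIntLinearMap) h hg t).1 ht₀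
  exact ⟨QuotientAddGroup.mk s, congrArg QuotientAddGroup.mk hs⟩

theorem exact_map_id_right {f : M →ₗ[Rᵐᵒᵖ] M'} {g : M' →ₗ[Rᵐᵒᵖ] M''} (h : Function.Exact f g)
    (hg : Function.Surjective g) {t : BalancedTensor R M' N}
    (ht : map g (LinearMap.id : N →ₗ[R] N) t = 0) :
    ∃ s : BalancedTensor R M N, map f LinearMap.id s = t := by
  obtain ⟨t, ht₀, rfl⟩ := exists_rep_of_map_eq_zero (g := LinearMap.id) hg Function.surjective_id ht
  obtain ⟨s, hs⟩ := (rTensor_exact N (f := f.toAddMonoidHom.toIntLinearMap)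
    (g := g.toAddMonoidHom.toIntLinearMap) h hg t).1 ht₀
  exact ⟨QuotientAddGroup.mk s, congrArg QuotientAddGroup.mk hs⟩

end

section Free

variable (M : Type u) [AddCommGroup M] [Module Rᵐᵒᵖ M] (X : Type u)

/-- The coordinate map `M ⊗_R R^(X) → M`, `m ⊗ v ↦ m (v x)`. -/
noncomputable def coord (x : X) : BalancedTensor R M (X →₀ R) →+ M :=
  QuotientAddGroup.lift _ (TensorProduct.liftAddHom
    (AddMonoidHom.mk' (fun m => AddMonoidHom.mk' (fun v : X →₀ R => MulOpposite.op (v x) • m)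
      fun v w => by simp [add_smul]) fun m m' => AddMonoidHom.ext fun v => smul_add _ _ _)
    fun n m v => by
      change MulOpposite.op (v x) • (n • m) = MulOpposite.op ((n • v) x) • m
      rw [Finsupp.smul_apply, MulOpposite.op_smul, smul_comm, smul_assoc]) <| by
    refine (AddSubgroup.closure_le _).2 ?_
    rintro _ ⟨m, r, v, rfl⟩
    change TensorProduct.liftAddHom _ _ _ = 0
    rw [map_sub, sub_eq_zero]
    change MulOpposite.op (v x) • MulOpposite.op r • m = MulOpposite.op ((r • v) x) • m
    simp [smul_smul]

variable {M X}

@[simp]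
theorem coord_tmul (x : X) (m : M) (v : X →₀ R) :
    coord M X x (tmul m v) = MulOpposite.op (v x) • m := rfl

theorem coord_map {M' : Type u} [AddCommGroup M'] [Module Rᵐᵒᵖ M'] (f : M →ₗ[Rᵐᵒᵖ] M') (x : X)
    (t : BalancedTensor R M (X →₀ R)) :
    coord M' X x (map f LinearMap.id t) = f (coord M X x t) := by
  induction t using induction_on with
  | zero => simp
  | tmul m n => simp
  | add x y hx hy => simp only [map_add, hx, hy]

theorem exists_finset_coord_eq_zero (t : BalancedTensor R M (X →₀ R)) :
    ∃ s : Finset X, ∀ x ∉ s, coord M X x t = 0 := by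
  classical
  induction t using induction_on with
  | zero => exact ⟨∅, by simp⟩
  | tmul m v => exact ⟨v.support, fun x hx => by simp [Finsupp.notMem_support_iff.1 hx]⟩
  | add a b ha hb =>
    obtain ⟨s, hs⟩ := ha
    obtain ⟨s', hs'⟩ := hb
    refine ⟨s ∪ s', fun x hx => ?_⟩
    rw [Finset.notMem_union] at hx
    rw [map_add, hs x hx.1, hs' x hx.2, add_zero]

/-- The coordinates identify `M ⊗_R R^(X)` with `X →₀ M`: the map `ψ` in the other direction is
onto, and `coord` reads off the entries of its argument. -/
theorem coord_injective {t t' : BalancedTensor R M (X →₀ R)}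
    (h : ∀ x, coord M X x t = coord M X x t') : t = t' := by
  classical
  let ψ : (X →₀ M) →+ BalancedTensor R M (X →₀ R) := Finsupp.liftAddHom fun x =>
    AddMonoidHom.mk' (fun m => tmul m (Finsupp.single x 1)) fun m m' => add_tmul _ _ _
  have hψ : ∀ x m, ψ (Finsupp.single x m) = tmul m (Finsupp.single x 1) := fun x m =>
    Finsupp.liftAddHom_apply_single _ _ _
  have hsurj : Function.Surjective ψ := by
    intro t
    induction t using induction_on with
    | zero => exact ⟨0, map_zero _⟩
    | tmul m v =>
      induction v using Finsupp.induction_linear with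
      | zero => exact ⟨0, by simp [tmul]⟩
      | add v w hv hw =>
        obtain ⟨a, ha⟩ := hv
        obtain ⟨b, hb⟩ := hw
        exact ⟨a + b, by rw [map_add, ha, hb, tmul_add]⟩
      | single x r =>
        refine ⟨Finsupp.single x (MulOpposite.op r • m), ?_⟩
        rw [hψ, smul_tmul, Finsupp.smul_single, smul_eq_mul, mul_one]
    | add a b ha hb =>
      obtain ⟨a, rfl⟩ := ha
      obtain ⟨b, rfl⟩ := hb
      exact ⟨a + b, map_add _ _ _⟩
  have hcoord : ∀ c x, coord M X x (ψ c) = c x := by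
    intro c x
    induction c using Finsupp.induction_linear with
    | zero => simp
    | add v w hv hw => rw [map_add, map_add, hv, hw, Finsupp.add_apply]
    | single y m =>
      rw [hψ, coord_tmul]
      by_cases hxy : y = x <;> simp [hxy]
  obtain ⟨c, rfl⟩ := hsurj t
  obtain ⟨c', rfl⟩ := hsurj t'
  congr 1
  ext x
  simpa [hcoord] using h x

end Free

/-- Tensoring an equationally pure map with any module gives an injective map. -/
theorem map_injective_of_isEquationallyPure {A B : Type u} [AddCommGroup A] [Module Rᵐᵒᵖ A]
    [AddCommGroup B] [Module Rᵐᵒᵖ B] {f : A →ₗ[Rᵐᵒᵖ] B} (hf : IsEquationallyPure f)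
    (X : Type u) [AddCommGroup X] [Module R X] :
    Function.Injective (map f (LinearMap.id : X →ₗ[R] X)) := by
  classical
  rw [injective_iff_map_eq_zero]
  intro t ht
  let p : (X →₀ R) →ₗ[R] X := Finsupp.linearCombination R id
  have hp : Function.Surjective p := Finsupp.linearCombination_id_surjective R X
  have hex : Function.Exact (LinearMap.ker p).subtype p := p.exact_subtype_ker_map
  obtain ⟨s, rfl⟩ := map_surjective (R := R) (M := A) (f := LinearMap.id) Function.surjective_id
    hp t
  rw [map_id_comm] at ht
  obtain ⟨w, hw⟩ := exact_map_id_left (N := LinearMap.ker p) hex hp ht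
  obtain ⟨n, b, v, rfl⟩ := exists_sum_tmul w
  -- In coordinates, `f ⊗ s` coming from `B ⊗ ker p` is a linear system solved by `b` in `B`, with
  -- constants the coordinates of `s` in `A`.
  have hv : ∀ x, ∑ j, MulOpposite.op ((v j).1 x) • b j = f (coord A X x s) := fun x => by
    rw [← coord_map, ← hw]
    simp [map_sum]
  obtain ⟨σ, hσ⟩ := exists_finset_coord_eq_zero s
  -- Outside `τ` all coefficients and constants vanish, so finitely many equations suffice.
  let τ : Finset X := σ ∪ Finset.univ.biUnion fun j => (v j).1.support
  obtain ⟨a, ha⟩ := hf.exists_solution (fun (x : τ) j => MulOpposite.op ((v j).1 x.1))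
    (fun x => coord A X x.1 s) b fun x => hv x
  have hs : s = map LinearMap.id (LinearMap.ker p).subtype (∑ j, tmul (a j) (v j)) := by
    refine coord_injective fun x => ?_
    simp only [map_sum, map_tmul, coord_tmul, LinearMap.id_apply, Submodule.subtype_apply]
    by_cases hx : x ∈ τ
    · exact (ha ⟨x, hx⟩).symm
    · simp only [τ, Finset.mem_union, Finset.mem_biUnion, Finset.mem_univ, true_and, not_or,
        not_exists, Finsupp.notMem_support_iff] at hx
      simp [hσ x hx.1, hx.2]
  rw [hs, map_map, hex.linearMap_comp_eq_zero, map_zero_right]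

end BalancedTensor

/-! ### Acyclicity of `M ⊗_R X` -/

section TensorAcyclic

variable {R : Type u} [Ring R] {X : ChainComplex (ModuleCat.{u} R) ℤ}

theorem chainComplex_acyclic_iff {C : Type*} [Category C] [Abelian C] (K : ChainComplex C ℤ) :
    K.Acyclic ↔ ∀ i j k : ℤ, j + 1 = i → k + 1 = j → (K.sc' i j k).Exact := by
  constructor
  · rintro h i j k rfl rfl
    exact (K.exactAt_iff' _ _ _ (by simp) (by simp)).1 (h _)
  · intro h j
    exact (K.exactAt_iff' (j + 1) j (j - 1) (by simp) (by simp)).2 (h _ _ _ rfl (by simp))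

theorem tensor_acyclic_iff (A : ModuleCat.{u} Rᵐᵒᵖ) :
    (((tensorFunctor A).mapHomologicalComplex _).obj X).Acyclic ↔
      ∀ i j k : ℤ, j + 1 = i → k + 1 = j → ∀ z : BalancedTensor R A (X.X j),
        BalancedTensor.map LinearMap.id (X.d j k).hom z = 0 →
          ∃ w : BalancedTensor R A (X.X i), BalancedTensor.map LinearMap.id (X.d i j).hom w = z := by
  simp only [chainComplex_acyclic_iff, ShortComplex.ab_exact_iff]
  rfl

/-- With `Z` the image of `X j → X k`, the sequence `A ⊗ X i → A ⊗ X j → A ⊗ Z` is exact, so a cycle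
must be shown to die in `A ⊗ Z`. By purity this can be tested in `B ⊗ Z`, where the cycle has become
a boundary. -/
theorem tensor_acyclic_of_isEquationallyPure (hX : X.Acyclic) {A B : ModuleCat.{u} Rᵐᵒᵖ}
    {f : A →ₗ[Rᵐᵒᵖ] B} (hf : IsEquationallyPure f)
    (hB : (((tensorFunctor B).mapHomologicalComplex _).obj X).Acyclic) :
    (((tensorFunctor A).mapHomologicalComplex _).obj X).Acyclic := by
  rw [tensor_acyclic_iff] at hB ⊢
  intro i j k hi hk z hz
  have hex := (chainComplex_acyclic_iff X).1 hX i j k hi hk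
  rw [ShortComplex.ShortExact.moduleCat_exact_iff_function_exact] at hex
  let p := (X.d j k).hom.rangeRestrict
  have hp : Function.Surjective p := (X.d j k).hom.surjective_rangeRestrict
  have hdp : Function.Exact (X.d i j).hom p := fun x => by
    exact Subtype.ext_iff.trans (hex x)
  refine BalancedTensor.exact_map_id_left hdp hp ?_
  refine BalancedTensor.map_injective_of_isEquationallyPure hf _ ?_
  obtain ⟨w, hw⟩ := hB i j k hi hk (BalancedTensor.map f LinearMap.id z) (by
    rw [← BalancedTensor.map_id_comm, hz, map_zero])
  rw [BalancedTensor.map_id_comm, ← hw, BalancedTensor.map_map, hdp.linearMap_comp_eq_zero,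
    BalancedTensor.map_zero_right, map_zero]

/-- Purity of `f` makes `N ⊗ X → P ⊗ X` injective in each degree; the rest is the chase for a
quotient of acyclic complexes. -/
theorem tensor_acyclic_of_exact {N P M : ModuleCat.{u} Rᵐᵒᵖ} {f : N →ₗ[Rᵐᵒᵖ] P}
    {g : P →ₗ[Rᵐᵒᵖ] M} (hf : IsEquationallyPure f) (hfg : Function.Exact f g)
    (hg : Function.Surjective g)
    (hN : (((tensorFunctor N).mapHomologicalComplex _).obj X).Acyclic)
    (hP : (((tensorFunctor P).mapHomologicalComplex _).obj X).Acyclic) :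
    (((tensorFunctor M).mapHomologicalComplex _).obj X).Acyclic := by
  rw [tensor_acyclic_iff] at hN hP ⊢
  intro i j k hi hk z hz
  have hdd : ∀ a b c : ℤ, (X.d b c).hom ∘ₗ (X.d a b).hom = 0 := fun a b c => by
    rw [← ModuleCat.hom_comp, X.d_comp_d, ModuleCat.hom_zero]
  obtain ⟨z, rfl⟩ := BalancedTensor.map_surjective (g := LinearMap.id) hg Function.surjective_id z
  rw [← BalancedTensor.map_id_comm] at hz
  obtain ⟨w, hw⟩ := BalancedTensor.exact_map_id_right hfg hg hz
  obtain ⟨v, rfl⟩ := hN j k (k - 1) hk (by simp) w (by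
    refine BalancedTensor.map_injective_of_isEquationallyPure hf _ ?_
    rw [BalancedTensor.map_id_comm, hw, BalancedTensor.map_map, hdd,
      BalancedTensor.map_zero_right, map_zero])
  rw [BalancedTensor.map_id_comm] at hw
  obtain ⟨y, hy⟩ := hP i j k hi hk (z - BalancedTensor.map f LinearMap.id v) (by
    rw [map_sub, hw, sub_self])
  refine ⟨BalancedTensor.map g LinearMap.id y, ?_⟩
  rw [← BalancedTensor.map_id_comm, hy, map_sub, BalancedTensor.map_map,
    hfg.linearMap_comp_eq_zero, BalancedTensor.map_zero_left, sub_zero]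

theorem isTensorAcyclic_inj_iff (hX : X.Acyclic) :
    IsTensorAcyclic (Inj Rᵐᵒᵖ) X ↔ IsTensorAcyclic (DefInj Rᵐᵒᵖ) X := by
  refine ⟨fun h M hM => ?_, fun h A hA => h A fun D _ hInj => hInj A hA⟩
  obtain ⟨I, P, N, j, g, i, hI, hg, hjg, hi, hij⟩ :=
    (defInj_le_pureSubquotientOfInj M hM).exists_exact
  exact tensor_acyclic_of_exact hij.of_comp hjg hg
    (tensor_acyclic_of_isEquationallyPure hX hij (h I hI))
    (tensor_acyclic_of_isEquationallyPure hX hi (h I hI))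

end TensorAcyclic

/-! ### Acyclicity of `Hom(M, X)` -/

section HomAcyclic

variable {S : Type u} [Ring S] {X : ChainComplex (ModuleCat.{u} S) ℤ}

theorem hom_acyclic_iff (A : ModuleCat.{u} S) :
    (((preadditiveCoyoneda.obj (Opposite.op A)).mapHomologicalComplex _).obj X).Acyclic ↔
      ∀ i j k : ℤ, j + 1 = i → k + 1 = j → ∀ z : A ⟶ X.X j, z ≫ X.d j k = 0 →
        ∃ w : A ⟶ X.X i, w ≫ X.d i j = z := by
  simp only [chainComplex_acyclic_iff, ShortComplex.ab_exact_iff]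
  rfl

/-- Injectivity of the `X n` makes `Hom(T.X₂, X) → Hom(T.X₁, X)` surjective in each degree, so the
outer acyclicity follows by a chase. -/
theorem hom_acyclic_of_shortExact (hX : ∀ n, Injective (X.X n))
    {T : ShortComplex (ModuleCat.{u} S)} (hT : T.ShortExact)
    (h₁ : (((preadditiveCoyoneda.obj (Opposite.op T.X₁)).mapHomologicalComplex _).obj X).Acyclic)
    (h₂ : (((preadditiveCoyoneda.obj (Opposite.op T.X₂)).mapHomologicalComplex _).obj X).Acyclic) :
    (((preadditiveCoyoneda.obj (Opposite.op T.X₃)).mapHomologicalComplex _).obj X).Acyclic := by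
  rw [hom_acyclic_iff] at h₁ h₂ ⊢
  intro i j k hi hk z hz
  have := hT.mono_f
  have := hT.epi_g
  obtain ⟨w, hw⟩ := h₂ i j k hi hk (T.g ≫ z) (by rw [Category.assoc, hz, Limits.comp_zero])
  obtain ⟨v, hv⟩ := h₁ (i + 1) i j rfl hi (T.f ≫ w) (by
    rw [Category.assoc, hw, T.zero_assoc, Limits.zero_comp])
  -- Extending `v` along `T.f` and subtracting its boundary makes `w` vanish on `T.X₁` and descend
  -- to `T.X₃`, with the same image under the differential.
  have hv' : T.f ≫ (w - Injective.factorThru v T.f ≫ X.d (i + 1) i) = 0 := by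
    rw [Preadditive.comp_sub, Injective.comp_factorThru_assoc, hv, sub_self]
  refine ⟨hT.exact.desc _ hv', ?_⟩
  rw [← cancel_epi T.g, hT.exact.g_desc_assoc, Preadditive.sub_comp, hw, Category.assoc,
    X.d_comp_d, Limits.comp_zero, sub_zero]

theorem isHomAcyclic_fpInj_iff (hX : ∀ n, Injective (X.X n)) :
    IsHomAcyclic (FPInj S) X ↔ IsHomAcyclic (DefInj S) X := by
  refine ⟨fun h M hM => ?_, fun h A hA => h A (fpInj_le_defInj A hA)⟩
  obtain ⟨I, P, N, j, g, i, hI, hg, hjg, hi, hij⟩ :=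
    (defInj_le_pureSubquotientOfInj M hM).exists_exact
  let T : ShortComplex (ModuleCat.{u} S) :=
    ShortComplex.mk (ModuleCat.ofHom j) (ModuleCat.ofHom g)
      (by rw [← ModuleCat.ofHom_comp, hjg.linearMap_comp_eq_zero, ModuleCat.ofHom_zero])
  have hT : T.ShortExact :=
    { exact := (ShortComplex.ShortExact.moduleCat_exact_iff_function_exact T).2 hjg
      mono_f := (ModuleCat.mono_iff_injective _).2 hij.of_comp.injective
      epi_g := (ModuleCat.epi_iff_surjective _).2 hg }
  exact hom_acyclic_of_shortExact hX hT (h N hij.isPureInjection.fpInj)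
    (h P hi.isPureInjection.fpInj)

end HomAcyclic

end DingModules

theorem mainTheorem9 (R : Type u) [Ring R] :
    -- Ding injective modules: the equivalence, and the statement about the complexes themselves
    (∀ N : ModuleCat.{u} Rᵐᵒᵖ,
      DingModules.IsDingInjective N ↔
        DingModules.IsGorensteinInjective (DingModules.DefInj Rᵐᵒᵖ) N) ∧
    (∀ E : ChainComplex (ModuleCat.{u} Rᵐᵒᵖ) ℤ, E.Acyclic →
      (∀ n, CategoryTheory.Injective (E.X n)) →
      (DingModules.IsHomAcyclic (DingModules.FPInj Rᵐᵒᵖ) E ↔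
        DingModules.IsHomAcyclic (DingModules.DefInj Rᵐᵒᵖ) E)) ∧
    -- Gorenstein flat modules
    (∀ N : ModuleCat.{u} R,
      DingModules.IsGorensteinFlat N ↔
        DingModules.IsGorensteinFlatRel (DingModules.DefInj Rᵐᵒᵖ) N) ∧
    (∀ F : ChainComplex (ModuleCat.{u} R) ℤ, F.Acyclic →
      (∀ n, DingModules.IsFlat (F.X n)) →
      (DingModules.IsTensorAcyclic (DingModules.Inj Rᵐᵒᵖ) F ↔
        DingModules.IsTensorAcyclic (DingModules.DefInj Rᵐᵒᵖ) F)) ∧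
    -- projectively coresolved Gorenstein flat modules
    (∀ N : ModuleCat.{u} R,
      DingModules.IsPGF N ↔ DingModules.IsPGFRel (DingModules.DefInj Rᵐᵒᵖ) N) ∧
    (∀ P : ChainComplex (ModuleCat.{u} R) ℤ, P.Acyclic →
      (∀ n, CategoryTheory.Projective (P.X n)) →
      (DingModules.IsTensorAcyclic (DingModules.Inj Rᵐᵒᵖ) P ↔
        DingModules.IsTensorAcyclic (DingModules.DefInj Rᵐᵒᵖ) P)) := by
  refine ⟨fun N => ?_, fun E _ hE => DingModules.isHomAcyclic_fpInj_iff hE, fun N => ?_,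
    fun F hF _ => DingModules.isTensorAcyclic_inj_iff hF, fun N => ?_,
    fun P hP _ => DingModules.isTensorAcyclic_inj_iff hP⟩
  · exact exists_congr fun E => and_congr_right fun _ => and_congr_right fun hE =>
      and_congr_left fun _ => DingModules.isHomAcyclic_fpInj_iff hE
  · exact exists_congr fun F => and_congr_right fun hF => and_congr_right fun _ =>
      and_congr_left fun _ => DingModules.isTensorAcyclic_inj_iff hF
  · exact exists_congr fun P => and_congr_right fun hP => and_congr_right fun _ =>
      and_congr_left fun _ => DingModules.isTensorAcyclic_inj_iff hP
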